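/- Let $n,m,k,d$ be natural numbers with $1\le k\le n$. Let $G$ be a bipartite graph with $n$ variable (left) nodes and $m$ check (right) nodes that is a $(2k,1/16)$-expander of left degree $d$: every variable node has exactly $d$ neighbours, and every nonempty set $T$ of at most $2k$ variable nodes has a neighbourhood $\mathcal N(T)$ with $|\mathcal N(T)|>(1-\tfrac1{16})\,d\,|T|$. Let $A\in\{0,1\}^{m\times n}$ be its adjacency matrix and $\Phi=A/d$. Let $\Lambda$ be a set of at most $m$ variable nodes whose neighbourhood consists of all check nodes, and let $I_\Lambda\in\{0,1\}^n$ be its indicator vector. Let $\alpha^*\in\mathbb R^n$ satisfy $\|\alpha^*\|_1=1$ and $\Phi\alpha^*\succeq 0$ (for instance $\alpha^*\succeq0$). Let $S$ be a set of $k$ largest in magnitude coordinates of $\alpha^*$, and let $\alpha^*_{\overline S}$ be the vector obtained from $\alpha^*$ by setting the coordinates in $S$ to zero. Let $\Theta\subset\mathbb R^n$ be a finite nonempty set of vectors $f\succeq 0$ with $\|f\|_1=1$, let $\lambda>0$, and put $\Gamma=\{f+\lambda I_\Lambda: f\in\Theta\}$. Let $\mathrm{pen}:\Gamma\to[0,\infty)$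 satisfy the Kraft inequality $\sum_{x\in\Gamma}e^{-\mathrm{pen}(x)}\le 1$, and write $\widehat{\mathrm{pen}}(f)=\mathrm{pen}(f+\lambda I_\Lambda)$ for $f\in\Theta$. Let $Y=(Y_1,\dots,Y_m)$ have independent coordinates, $Y_j$ being Poisson distributed with mean $(\Phi\alpha^*)_j$ (equal to $0$ almost surely if this mean is $0$). Let $\hat x$ be a minimizer over $x\in\Gamma$ of $$\sum_{j=1}^m\Big((\Phi x)_j-Y_j\log(\Phi x)_j\Big)+2\,\mathrm{pen}(x),$$ and let $\hat f\in\Theta$ be the corresponding candidate, $\hat x=\hat f+\lambda I_\Lambda$ (with $\hat f$ chosen measurably). Then $\|\alpha^*-\hat f\|_1$ is integrable and $$\mathbb E\,\|\alpha^*-\hat f\|_1\;\le\;3\lambda m+4\|\alpha^*_{\overline S}\|_1+3\sqrt6\,\min_{\tilde f\in\Theta}\left[\sqrt{\tfrac d\lambda}\,\Big(\|\alpha^*-\tilde f\|_1+\lambda m\Big)+\sqrt{2\,\widehat{\mathrm{pen}}(\tilde f)}\right].$$ In particular this holds when $\lambda\ll\frac1{k\log(n/k)}$. -/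

import Mathlib

open MeasureTheory ProbabilityTheory

namespace ExpanderPoisson

/-- A (simple) bipartite graph with variable nodes `Fin n` and check nodes `Fin m`,
given by the set of check nodes adjacent to each variable node. -/
structure BipartiteGraph (n m : ℕ) where
  /-- the neighbours of a variable node -/
  nbr : Fin n → Finset (Fin m)

/-- The set `N(S)` of all check nodes adjacent to some variable node of `S`. -/
def BipartiteGraph.nbrs {n m : ℕ} (G : BipartiteGraph n m) (S : Finset (Fin n)) :
    Finset (Fin m) :=
  S.biUnion G.nbr

/-- `G` is a `(k, ε)`-expander with left degree `d`: it is left regular of degree `d`, and every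
nonempty set `S` of at most `k` variable nodes has more than `(1 - ε) d |S|` neighbours. -/
structure BipartiteGraph.IsExpander {n m : ℕ} (G : BipartiteGraph n m) (k : ℕ) (ε : ℝ) (d : ℕ) :
    Prop where
  left_regular : ∀ i, (G.nbr i).card = d
  expansion : ∀ S : Finset (Fin n), S.Nonempty → S.card ≤ k →
    (1 - ε) * d * S.card < ((G.nbrs S).card : ℝ)

/-- The `m × n` adjacency matrix, rows indexed by check nodes, columns by variable nodes. -/
def BipartiteGraph.adjMatrix {n m : ℕ} (G : BipartiteGraph n m) : Matrix (Fin m) (Fin n) ℝ :=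
  Matrix.of fun j i => if j ∈ G.nbr i then 1 else 0

/-- The normalized sensing matrix `Φ = A / d`. -/
noncomputable def BipartiteGraph.sensingMatrix {n m : ℕ} (G : BipartiteGraph n m) (d : ℕ) :
    Matrix (Fin m) (Fin n) ℝ :=
  (d : ℝ)⁻¹ • G.adjMatrix

/-- The `ℓ₁` norm on `ℝⁿ`. -/
def l1Norm {n : ℕ} (x : Fin n → ℝ) : ℝ := ∑ i, |x i|

/-- The vector that agrees with `x` on `S` and vanishes off `S`. -/
def restrict {n : ℕ} (x : Fin n → ℝ) (S : Finset (Fin n)) : Fin n → ℝ :=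
  fun i => if i ∈ S then x i else 0

/-- `S` is a set of `k` largest (in magnitude) coordinates of `x`. -/
def IsLargestCoords {n : ℕ} (x : Fin n → ℝ) (k : ℕ) (S : Finset (Fin n)) : Prop :=
  S.card = k ∧ ∀ i ∈ S, ∀ j ∉ S, |x j| ≤ |x i|

/-- The index vector `I_Λ` of a set of variable nodes. -/
def indexVector {n : ℕ} (L : Finset (Fin n)) : Fin n → ℝ :=
  fun i => if i ∈ L then 1 else 0

/-- The shifted candidate set `Γ = {f + λ I_Λ : f ∈ Θ}`. -/
noncomputable def shiftedCandidates {n : ℕ} (Θ : Finset (Fin n → ℝ)) (lam : ℝ)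
    (L : Finset (Fin n)) : Finset (Fin n → ℝ) :=
  Θ.image fun f => f + lam • indexVector L

/-- The objective of the penalized Poisson likelihood (MAP) decoder for the observation `y`:
`∑ⱼ ((Φx)ⱼ - yⱼ log (Φx)ⱼ) + 2 pen(x)`. -/
noncomputable def mapObjective {n m : ℕ} (Φ : Matrix (Fin m) (Fin n) ℝ)
    (pen : (Fin n → ℝ) → ℝ) (y : Fin m → ℕ) (x : Fin n → ℝ) : ℝ :=
  (∑ j, (Φ.mulVec x j - (y j : ℝ) * Real.log (Φ.mulVec x j))) + 2 * pen x

/-- `xhat` is a MAP estimate over `Γ` for the observation `y`. -/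
def IsMapEstimate {n m : ℕ} (Φ : Matrix (Fin m) (Fin n) ℝ) (pen : (Fin n → ℝ) → ℝ)
    (Γ : Finset (Fin n → ℝ)) (y : Fin m → ℕ) (xhat : Fin n → ℝ) : Prop :=
  xhat ∈ Γ ∧ ∀ x ∈ Γ, mapObjective Φ pen y xhat ≤ mapObjective Φ pen y x

/-- `Y ~ Poisson(β)`: the coordinates of `Y` are independent, the `j`-th one being Poisson with
mean `β j` (meant for `β ≥ 0`; mean `0` is the point mass at `0`). -/
def IsPoissonVector {m : ℕ} {Ω : Type*} [MeasurableSpace Ω] (P : Measure Ω)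
    (Y : Ω → Fin m → ℕ) (β : Fin m → ℝ) : Prop :=
  (∀ j, HasLaw (fun ω => Y ω j) (poissonMeasure (β j).toNNReal) P) ∧
    iIndepFun (fun j ω => Y ω j) P

end ExpanderPoisson

open ExpanderPoisson

/-!
The proof has a deterministic and a statistical half.

*Expansion.* Let `N` be the neighbourhood of `k` variable nodes carrying the largest entries of a
vector `y`. Each check node of `N` receives the entry of its largest neighbour, disturbed by its
other neighbours. Ordering the nodes by `|y i|` and charging every disturbing edge to its
variable node, expansion bounds the total charge of the first `p` nodes by `2 ε d p` (`sum_lossWeight_le`);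
for `p > 2 k` this follows by averaging over sets of `k` nodes. Abel summation then gives
`‖y_S‖₁ ≤ ‖Φ y‖₁ + 2 ε ‖y‖₁` for every `S` with `k` elements (`sum_abs_le_of_expansion`).
If `‖v‖₁ ≤ ‖u‖₁`, then `y = u - v` satisfies `‖y‖₁ ≤ 2 ‖y_S‖₁ + 2 ‖u_{Sᶜ}‖₁`, and for `ε = 1/16` this
yields `‖u - v‖₁ ≤ 4 ‖u_{Sᶜ}‖₁ + 3 ‖Φ (u - v)‖₁` (`l1Norm_sub_le`). Charging all the nodes with
`2 ε d p`, rather than treating the first block apart, is what makes the constant `3` available.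

*Likelihood.* For Poisson vectors the Hellinger affinity is `exp (-H² / 2)`, where
`H² = ∑ⱼ (√βⱼ - √qⱼ)²`. By the Kraft inequality, the sum over the candidates of the likelihood ratios
to the power `1/2`, weighted by `exp (-pen + H² / 2)`, has expectation at most `1`. Comparing the
estimate with an arbitrary candidate `x` gives `E H² ≤ KL(β, Φ x) + 2 pen x`, and the divergence is at
most `∑ⱼ (βⱼ - qⱼ)² / qⱼ` (`IsPoissonVector.integral_sqHellinger_le`). The shift by `lam` bounds the
intensities below by `lam / d`, hence the divergence by `(d / lam) ‖β - Φ x‖₁²`.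

The two halves are joined by Cauchy–Schwarz, `‖β - q‖₁ ≤ H √(2 (‖β‖₁ + ‖q‖₁))`, where the second factor
is at most `√6` if `lam * m ≤ 1`. If `lam * m > 1` the claim is trivial, because `α` and the estimate
both have `ℓ₁` norm `1`.
-/

namespace ExpanderPoisson

/-! ### Sums over initial segments of `Fin n` -/

/-- The first `p` variable nodes (all of them when `n ≤ p`). -/
def firstNodes (n p : ℕ) : Finset (Fin n) := Finset.univ.filter fun i => i.val < p

lemma mem_firstNodes {n p : ℕ} {i : Fin n} : i ∈ firstNodes n p ↔ i.val < p := by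
  simp [firstNodes]

lemma firstNodes_zero (n : ℕ) : firstNodes n 0 = ∅ := by
  simp [firstNodes]

lemma firstNodes_self (n : ℕ) : firstNodes n n = Finset.univ := by
  ext i; simp [firstNodes]

lemma firstNodes_mono {n p q : ℕ} (h : p ≤ q) : firstNodes n p ⊆ firstNodes n q := by
  intro i; simp only [mem_firstNodes]; omega

lemma notMem_firstNodes_self {n p : ℕ} (h : p < n) : (⟨p, h⟩ : Fin n) ∉ firstNodes n p := by
  simp [mem_firstNodes]

lemma firstNodes_succ {n p : ℕ} (h : p < n) :
    firstNodes n (p + 1) = insert ⟨p, h⟩ (firstNodes n p) := by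
  ext i
  simp only [mem_firstNodes, Finset.mem_insert, Fin.ext_iff]
  omega

lemma sum_firstNodes_succ {n p : ℕ} (h : p < n) (f : Fin n → ℝ) :
    ∑ i ∈ firstNodes n (p + 1), f i = ∑ i ∈ firstNodes n p, f i + f ⟨p, h⟩ := by
  rw [firstNodes_succ h, Finset.sum_insert (notMem_firstNodes_self h), add_comm]

lemma card_firstNodes {n p : ℕ} (h : p ≤ n) : (firstNodes n p).card = p := by
  induction p with
  | zero => simp [firstNodes_zero]
  | succ p ih =>
    rw [firstNodes_succ h, Finset.card_insert_of_notMem (notMem_firstNodes_self h), ih (by omega)]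

/-- Abel summation: against a nonnegative antitone sequence, weights whose partial sums are
nonnegative have a nonnegative sum. -/
lemma sum_mul_nonneg_of_antitone {n : ℕ} (v a : Fin n → ℝ) (ha : Antitone a) (ha0 : ∀ i, 0 ≤ a i)
    (hv : ∀ p ≤ n, 0 ≤ ∑ i ∈ firstNodes n p, v i) : 0 ≤ ∑ i, v i * a i := by
  have key : ∀ p (h : p < n), a ⟨p, h⟩ * ∑ i ∈ firstNodes n (p + 1), v i
      ≤ ∑ i ∈ firstNodes n (p + 1), v i * a i := by
    intro p
    induction p with
    | zero =>
      intro h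
      simp [sum_firstNodes_succ h, firstNodes_zero, mul_comm]
    | succ p ih =>
      intro h
      have h1 := ih (by omega)
      have h2 : a ⟨p + 1, h⟩ ≤ a ⟨p, by omega⟩ := ha (by simp [Fin.le_def])
      have h3 := mul_le_mul_of_nonneg_right h2 (hv (p + 1) (by omega))
      rw [sum_firstNodes_succ h, sum_firstNodes_succ h (fun i => v i * a i), mul_add]
      linarith [mul_comm (a ⟨p + 1, h⟩) (v ⟨p + 1, h⟩)]
  rcases Nat.eq_zero_or_pos n with rfl | hn
  · simp
  obtain ⟨p, rfl⟩ : ∃ p, n = p + 1 := ⟨n - 1, by omega⟩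
  have h1 := key p (by omega)
  have h2 := mul_nonneg (ha0 ⟨p, by omega⟩) (hv (p + 1) le_rfl)
  rw [firstNodes_self] at h1 h2
  exact h2.trans h1

/-- For an antitone sequence, no set of `k` indices has a larger sum than the first `k`. -/
lemma sum_le_sum_firstNodes {n k : ℕ} (a : Fin n → ℝ) (ha : Antitone a) (ha0 : ∀ i, 0 ≤ a i)
    (S : Finset (Fin n)) (hS : S.card = k) :
    ∑ i ∈ S, a i ≤ ∑ i ∈ firstNodes n k, a i := by
  have hkn : k ≤ n := by simpa [hS] using S.card_le_univ
  have h := sum_mul_nonneg_of_antitone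
    (fun i => (if i ∈ firstNodes n k then (1 : ℝ) else 0) - if i ∈ S then 1 else 0) a ha ha0 ?_
  · simpa [sub_mul, Finset.sum_sub_distrib] using h
  · intro p hp
    simp only [Finset.sum_sub_distrib, Finset.sum_ite_mem, Finset.sum_const, nsmul_eq_mul, mul_one,
      sub_nonneg, Nat.cast_le]
    rcases le_total p k with h | h
    · rw [Finset.inter_eq_left.2 (firstNodes_mono h)]
      exact Finset.card_le_card Finset.inter_subset_left
    · rw [Finset.inter_eq_right.2 (firstNodes_mono h), card_firstNodes hkn, ← hS]
      exact Finset.card_le_card Finset.inter_subset_right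

/-- Averaging: a bound on the sums over all `k`-element subsets extends proportionally to larger
sets. -/
lemma sum_le_card_mul_of_powersetCard {ι : Type*} [DecidableEq ι] {k : ℕ} (hk : 1 ≤ k) (e : ι → ℝ)
    (q : ℝ) (T : Finset ι) (hT : k ≤ T.card)
    (h : ∀ U ⊆ T, U.card = k → ∑ i ∈ U, e i ≤ k * q) : ∑ i ∈ T, e i ≤ T.card * q := by
  induction hc : T.card using Nat.strong_induction_on generalizing T with
  | _ t ih =>
    rcases hT.eq_or_lt with hkT | hkT
    · rw [← hc, ← hkT]; exact h T subset_rfl hkT.symm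
    have h1 : ∀ i ∈ T, ∑ j ∈ T, e j - e i ≤ ((t : ℝ) - 1) * q := by
      intro i hi
      have hce : (T.erase i).card = t - 1 := by rw [Finset.card_erase_of_mem hi, hc]
      have := ih (t - 1) (by omega) (T.erase i) (by omega)
        (fun U hU => h U (hU.trans (Finset.erase_subset _ _))) hce
      rw [Nat.cast_sub (by omega), Nat.cast_one] at this
      linarith [Finset.add_sum_erase T e hi]
    have h2 := Finset.sum_le_sum h1
    simp only [Finset.sum_sub_distrib, Finset.sum_const, nsmul_eq_mul, hc] at h2
    have ht : (0 : ℝ) < (t : ℝ) - 1 := by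
      have : (2 : ℝ) ≤ t := by exact_mod_cast (by omega : 2 ≤ t)
      linarith
    refine le_of_mul_le_mul_left ?_ ht
    linarith

/-! ### Counting edges in an expander -/

/-- Adding the nodes of `T` to a set whose neighbourhood is `U` enlarges the neighbourhood by at
most the number of edges from `T` that avoid `U`. -/
lemma card_union_biUnion_le {ι κ : Type*} [DecidableEq κ] (N : ι → Finset κ) (U : Finset κ)
    (T : Finset ι) :
    ((U ∪ T.biUnion N).card : ℝ) ≤ U.card + ∑ i ∈ T, (((N i).card : ℝ) - (N i ∩ U).card) := by
  have h1 : U ∪ T.biUnion N ⊆ U ∪ T.biUnion fun i => N i \ U := by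
    intro j
    simp only [Finset.mem_union, Finset.mem_biUnion, Finset.mem_sdiff]
    by_cases hj : j ∈ U <;> simp [hj]
  have h2 : (U ∪ T.biUnion N).card ≤ U.card + ∑ i ∈ T, (N i \ U).card :=
    (Finset.card_le_card h1).trans ((Finset.card_union_le _ _).trans
      (Nat.add_le_add_left Finset.card_biUnion_le _))
  have h3 : ∀ i, ((N i \ U).card : ℝ) = (N i).card - (N i ∩ U).card := fun i => by
    have := Finset.card_sdiff_add_card_inter (N i) U
    rw [eq_sub_iff_add_eq]; exact_mod_cast this
  simp only [← h3]
  exact_mod_cast h2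

/-- The number of edges lost to repeated neighbours, when the node `i` is charged for its edges
to check nodes already reached by smaller nodes. -/
lemma sum_collisions {n m : ℕ} (N : Fin n → Finset (Fin m)) {p : ℕ} (hp : p ≤ n) :
    ∑ i ∈ firstNodes n p, ((N i ∩ (firstNodes n i).biUnion N).card : ℝ) =
      ∑ i ∈ firstNodes n p, ((N i).card : ℝ) - ((firstNodes n p).biUnion N).card := by
  induction p with
  | zero => simp [firstNodes_zero]
  | succ p ih =>
    rw [sum_firstNodes_succ hp, sum_firstNodes_succ hp, ih (by omega), firstNodes_succ hp,
      Finset.biUnion_insert]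
    have := Finset.card_union_add_card_inter (N ⟨p, hp⟩) ((firstNodes n p).biUnion N)
    have h : (((N ⟨p, hp⟩ ∪ (firstNodes n p).biUnion N).card : ℝ)
      + (N ⟨p, hp⟩ ∩ (firstNodes n p).biUnion N).card) =
      (N ⟨p, hp⟩).card + ((firstNodes n p).biUnion N).card := by exact_mod_cast this
    linarith

/-- The weight with which `|y i|` may be lost in `‖A y‖₁`, compared with the ideal situation in
which the edges leaving the first `k` nodes have distinct ends: among the first `k` nodes twice
the number of edges to a check node already reached, for the others the number of edges into the
neighbourhood of the first `k` nodes. -/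
def lossWeight {n m : ℕ} (N : Fin n → Finset (Fin m)) (k : ℕ) (i : Fin n) : ℝ :=
  if i.val < k then 2 * ((N i ∩ (firstNodes n i).biUnion N).card : ℝ)
  else ((N i ∩ (firstNodes n k).biUnion N).card : ℝ)

/-- Expansion bounds the partial sums of the loss weights linearly. Beyond `2 * k` nodes, where the
expansion hypothesis gives nothing directly, one averages over the sets of `k` nodes. -/
lemma sum_lossWeight_le {n m k d : ℕ} (hk : 1 ≤ k) (hkn : k ≤ n) (N : Fin n → Finset (Fin m))
    (η : ℝ) (hη : 0 ≤ η) (hd : ∀ i, (N i).card = d)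
    (hN : ∀ T : Finset (Fin n), T.card ≤ 2 * k → (d - η) * T.card ≤ ((T.biUnion N).card : ℝ))
    {p : ℕ} (hp : p ≤ n) :
    ∑ i ∈ firstNodes n p, lossWeight N k i ≤ 2 * η * p := by
  have hC : ∀ p ≤ n, p ≤ k →
      ∑ i ∈ firstNodes n p, ((N i ∩ (firstNodes n i).biUnion N).card : ℝ) ≤ η * p := by
    intro p hp hpk
    have h := hN (firstNodes n p) (by rw [card_firstNodes hp]; omega)
    rw [sum_collisions N hp]
    simp only [hd, Finset.sum_const, nsmul_eq_mul, card_firstNodes hp] at h ⊢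
    linarith
  have hW : ∀ p ≤ k, ∑ i ∈ firstNodes n p, lossWeight N k i =
      2 * ∑ i ∈ firstNodes n p, ((N i ∩ (firstNodes n i).biUnion N).card : ℝ) := by
    intro p hpk
    rw [Finset.mul_sum]
    refine Finset.sum_congr rfl fun i hi => ?_
    rw [lossWeight, if_pos ((mem_firstNodes.1 hi).trans_le hpk)]
  rcases le_total p k with hpk | hkp
  · rw [hW p hpk]
    linarith [hC p hp hpk]
  set C := ∑ i ∈ firstNodes n k, ((N i ∩ (firstNodes n i).biUnion N).card : ℝ) with hCdef
  set T := firstNodes n p \ firstNodes n k with hT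
  have hTcard : T.card = p - k := by
    rw [hT, Finset.card_sdiff_of_subset (firstNodes_mono hkp), card_firstNodes hp,
      card_firstNodes hkn]
  have hCk : C ≤ η * k := hC k hkn le_rfl
  have hsplit : ∑ i ∈ firstNodes n p, lossWeight N k i =
      ∑ i ∈ T, ((N i ∩ (firstNodes n k).biUnion N).card : ℝ) + 2 * C := by
    rw [← Finset.sum_sdiff (firstNodes_mono hkp), hW k le_rfl]
    congr 1
    refine Finset.sum_congr rfl fun i hi => ?_
    have : ¬ i.val < k := fun h => (Finset.mem_sdiff.1 hi).2 (mem_firstNodes.2 h)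
    rw [lossWeight, if_neg this]
  -- the nodes of `U` must together reach many check nodes outside the neighbourhood of the first `k`
  have hedge : ∀ U ⊆ T, U.card ≤ k →
      ∑ i ∈ U, ((N i ∩ (firstNodes n k).biUnion N).card : ℝ) ≤ η * (k + U.card) - C := by
    intro U hU hUk
    have hdisj : Disjoint (firstNodes n k) U :=
      (Finset.disjoint_sdiff (s := firstNodes n k)).mono_right hU
    have hcard : (firstNodes n k ∪ U).card = k + U.card := by
      rw [Finset.card_union_of_disjoint hdisj, card_firstNodes hkn]
    have h1 := hN (firstNodes n k ∪ U) (by omega)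
    have h2 := card_union_biUnion_le N ((firstNodes n k).biUnion N) U
    have h3 := sum_collisions N hkn
    rw [Finset.union_biUnion, hcard] at h1
    simp only [hd, Finset.sum_const, Finset.sum_sub_distrib, nsmul_eq_mul,
      card_firstNodes hkn] at h2 h3
    push_cast at h1
    rw [← hCdef] at h3
    linarith
  have hpc : (p : ℝ) = T.card + k := by
    rw [hTcard, Nat.cast_sub hkp]; ring
  rw [hsplit, hpc]
  rcases le_total T.card k with h | h
  · have h1 := hedge T subset_rfl h
    have h2 : 0 ≤ η * T.card := by positivity
    linarith
  · have hk0 : (0 : ℝ) < k := by exact_mod_cast hk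
    have h1 := sum_le_card_mul_of_powersetCard hk
      (fun i => ((N i ∩ (firstNodes n k).biUnion N).card : ℝ)) (2 * η - C / k) T h
      (fun U hU hUk => by
        refine (hedge U hU hUk.le).trans (le_of_eq ?_)
        rw [hUk]; field_simp; ring)
    have hC0 : 0 ≤ C := Finset.sum_nonneg fun i _ => by positivity
    have h2 : C ≤ T.card * (C / k) := by
      rw [mul_div_assoc', le_div_iff₀ hk0, mul_comm]
      exact mul_le_mul_of_nonneg_right (by exact_mod_cast h) hC0
    nlinarith

/-! ### From edge counts to the `ℓ₁` norm -/

/-- At a check node `j` reached by the first `k` nodes, the first node `i₀` reaching it survives in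
the sum and every other neighbour of `j` is charged to its loss weight. -/
lemma sum_firstNodes_sub_loss_le_abs {n m : ℕ} (N : Fin n → Finset (Fin m)) (k : ℕ)
    (y : Fin n → ℝ) (j : Fin m) :
    ∑ i, ((if i ∈ firstNodes n k ∧ j ∈ N i then (1 : ℝ) else 0) -
      (if i.val < k then 2 * (if j ∈ N i ∩ (firstNodes n i).biUnion N then (1 : ℝ) else 0)
        else if j ∈ N i ∩ (firstNodes n k).biUnion N then 1 else 0)) * |y i|
      ≤ |∑ i, if j ∈ N i then y i else 0| := by
  by_cases hj : j ∈ (firstNodes n k).biUnion N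
  · have hne : (Finset.univ.filter fun i => j ∈ N i).Nonempty := by
      obtain ⟨i, -, hi⟩ := Finset.mem_biUnion.1 hj
      exact ⟨i, by simpa using hi⟩
    set i₀ := (Finset.univ.filter fun i => j ∈ N i).min' hne with hi₀
    have hmem : j ∈ N i₀ := (Finset.mem_filter.1 (Finset.min'_mem _ hne)).2
    have hmin : ∀ i, j ∈ N i → i₀ ≤ i := fun i hi => Finset.min'_le _ _ (by simpa using hi)
    have hi₀k : i₀.val < k := by
      obtain ⟨i, hik, hi⟩ := Finset.mem_biUnion.1 hj
      exact lt_of_le_of_lt (Fin.le_def.1 (hmin i hi)) (mem_firstNodes.1 hik)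
    have hnew : j ∉ (firstNodes n i₀).biUnion N := by
      intro h
      obtain ⟨i, hik, hi⟩ := Finset.mem_biUnion.1 h
      exact absurd (hmin i hi) (not_le.2 (mem_firstNodes.1 hik))
    rw [← Finset.add_sum_erase _ _ (Finset.mem_univ i₀),
      ← Finset.add_sum_erase _ (fun i => if j ∈ N i then y i else 0) (Finset.mem_univ i₀)]
    have h1 : ∀ i ∈ Finset.univ.erase i₀,
        ((if i ∈ firstNodes n k ∧ j ∈ N i then (1 : ℝ) else 0) -
        (if i.val < k then 2 * (if j ∈ N i ∩ (firstNodes n i).biUnion N then (1 : ℝ) else 0)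
          else if j ∈ N i ∩ (firstNodes n k).biUnion N then 1 else 0)) * |y i|
        ≤ -|if j ∈ N i then y i else 0| := by
      intro i hi
      by_cases hji : j ∈ N i
      · have hlt : i₀ < i := lt_of_le_of_ne (hmin i hji) (Finset.ne_of_mem_erase hi).symm
        have hold : j ∈ (firstNodes n i).biUnion N :=
          Finset.mem_biUnion.2 ⟨i₀, mem_firstNodes.2 hlt, hmem⟩
        by_cases hik : i.val < k
        · simp only [hik, hji, hold, mem_firstNodes, Finset.mem_inter, and_self, if_true]
          linarith
        · simp only [hik, hji, hj, mem_firstNodes, Finset.mem_inter, and_self, if_true, if_false,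
            false_and]
          linarith
      · simp [hji]
    have h2 := Finset.sum_le_sum h1
    have h3 := Finset.abs_sum_le_sum_abs (fun i => if j ∈ N i then y i else 0)
      (Finset.univ.erase i₀)
    simp only [Finset.sum_neg_distrib] at h2
    have h4 := abs_sub_abs_le_abs_add (y i₀)
      (∑ i ∈ Finset.univ.erase i₀, if j ∈ N i then y i else 0)
    rw [if_pos ⟨mem_firstNodes.2 hi₀k, hmem⟩, if_pos hi₀k,
      if_neg fun h => hnew (Finset.mem_inter.1 h).2, if_pos hmem]
    linarith
  · refine le_trans (Finset.sum_nonpos fun i _ => ?_) (abs_nonneg _)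
    have h : ¬ (i ∈ firstNodes n k ∧ j ∈ N i) := fun h => hj (Finset.mem_biUnion.2 ⟨i, h⟩)
    rw [if_neg h]
    refine mul_nonpos_of_nonpos_of_nonneg ?_ (abs_nonneg _)
    split_ifs <;> norm_num

/-- The ordered case of `sum_abs_le_of_expansion`. -/
lemma sum_firstNodes_abs_le {n m k d : ℕ} (hk : 1 ≤ k) (hkn : k ≤ n) (N : Fin n → Finset (Fin m))
    (η : ℝ) (hη : 0 ≤ η) (hd : ∀ i, (N i).card = d)
    (hN : ∀ T : Finset (Fin n), T.card ≤ 2 * k → (d - η) * T.card ≤ ((T.biUnion N).card : ℝ))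
    (y : Fin n → ℝ) (hy : Antitone fun i => |y i|) :
    d * ∑ i ∈ firstNodes n k, |y i| ≤
      ∑ j, |∑ i, if j ∈ N i then y i else 0| + 2 * η * ∑ i, |y i| := by
  have h1 := Finset.sum_le_sum fun j (_ : j ∈ Finset.univ) =>
    sum_firstNodes_sub_loss_le_abs N k y j
  have hcount : ∀ s : Finset (Fin m), ∑ j, (if j ∈ s then (1 : ℝ) else 0) = s.card := by
    intro s; simp
  have h2 : ∀ i, ∑ j, ((if i ∈ firstNodes n k ∧ j ∈ N i then (1 : ℝ) else 0) -
      (if i.val < k then 2 * (if j ∈ N i ∩ (firstNodes n i).biUnion N then (1 : ℝ) else 0)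
        else if j ∈ N i ∩ (firstNodes n k).biUnion N then 1 else 0)) =
      (if i ∈ firstNodes n k then (d : ℝ) else 0) - lossWeight N k i := by
    intro i
    rw [Finset.sum_sub_distrib, lossWeight]
    congr 1
    · split_ifs with h
      · simp only [h, true_and, hcount, hd]
      · simp [h]
    · split_ifs with h
      · rw [← Finset.mul_sum, hcount]
      · rw [hcount]
  rw [Finset.sum_comm] at h1
  simp only [← Finset.sum_mul, h2] at h1
  have h3 := sum_mul_nonneg_of_antitone (fun i => 2 * η - lossWeight N k i) (fun i => |y i|) hy
    (fun i => abs_nonneg _) (fun p hp => by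
      have := sum_lossWeight_le hk hkn N η hη hd hN hp
      rw [Finset.sum_sub_distrib, Finset.sum_const, card_firstNodes hp, nsmul_eq_mul]
      linarith)
  simp only [sub_mul, Finset.sum_sub_distrib, ite_mul, zero_mul, Finset.sum_ite_mem,
    Finset.univ_inter, ← Finset.mul_sum] at h1 h3
  linarith

/-- In a graph whose node sets of size at most `2 * k` expand by the factor `d - η`, the mass of a
vector on any `k` nodes is controlled by its image under the adjacency matrix, up to the fraction
`2 * η / d` of its total mass. -/
lemma sum_abs_le_of_expansion {n m k d : ℕ} (hk : 1 ≤ k) (N : Fin n → Finset (Fin m))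
    (η : ℝ) (hη : 0 ≤ η) (hd : ∀ i, (N i).card = d)
    (hN : ∀ T : Finset (Fin n), T.card ≤ 2 * k → (d - η) * T.card ≤ ((T.biUnion N).card : ℝ))
    (y : Fin n → ℝ) (S : Finset (Fin n)) (hS : S.card = k) :
    d * ∑ i ∈ S, |y i| ≤
      ∑ j, |∑ i, if j ∈ N i then y i else 0| + 2 * η * ∑ i, |y i| := by
  have hkn : k ≤ n := by simpa [hS] using S.card_le_univ
  set σ := Tuple.sort fun i => -|y i| with hσ
  have hanti : Antitone fun i => |y (σ i)| := fun a b hab => by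
    have := Tuple.monotone_sort (fun i => -|y i|) hab
    simpa using this
  have h1 := sum_firstNodes_abs_le hk hkn (fun i => N (σ i)) η hη (fun i => hd _) (fun T hT => by
    have := hN (T.map σ.toEmbedding) (by simpa using hT)
    rw [Finset.card_map, Finset.map_eq_image, Finset.image_biUnion] at this
    exact this)
    (fun i => y (σ i)) hanti
  have h2 := sum_le_sum_firstNodes (fun i => |y (σ i)|) hanti (fun i => abs_nonneg _)
    (S.map σ.symm.toEmbedding) (by simpa using hS)
  rw [Equiv.sum_comp σ fun i => |y i|] at h1
  simp only [fun j => Equiv.sum_comp σ fun i => if j ∈ N i then y i else 0] at h1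
  simp only [Finset.sum_map, Equiv.coe_toEmbedding, Equiv.apply_symm_apply] at h2
  exact (mul_le_mul_of_nonneg_left h2 (Nat.cast_nonneg d)).trans h1

/-! ### Stability of the sensing matrix in the `ℓ₁` norm -/

lemma sensingMatrix_mulVec {n m : ℕ} (G : BipartiteGraph n m) (d : ℕ) (x : Fin n → ℝ)
    (j : Fin m) :
    (G.sensingMatrix d).mulVec x j = (d : ℝ)⁻¹ * ∑ i, if j ∈ G.nbr i then x i else 0 := by
  simp [BipartiteGraph.sensingMatrix, BipartiteGraph.adjMatrix, Matrix.mulVec, dotProduct,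
    Finset.mul_sum]

/-- A single node expands, hence has a neighbour. -/
lemma BipartiteGraph.IsExpander.degree_pos {n m k d : ℕ} {ε : ℝ} {G : BipartiteGraph n m}
    (hG : G.IsExpander k ε d) (hk : 1 ≤ k) (i : Fin n) : 0 < d := by
  rcases Nat.eq_zero_or_pos d with rfl | h
  · have h1 := hG.expansion {i} (Finset.singleton_nonempty i) (by simpa using hk)
    have h2 := hG.left_regular i
    simp [BipartiteGraph.nbrs, h2] at h1
  · exact h

lemma l1Norm_eq_sum_add_sum_compl {n : ℕ} (x : Fin n → ℝ) (S : Finset (Fin n)) :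
    l1Norm x = ∑ i ∈ S, |x i| + ∑ i ∈ Sᶜ, |x i| :=
  (Finset.sum_add_sum_compl S _).symm

lemma l1Norm_restrict {n : ℕ} (x : Fin n → ℝ) (S : Finset (Fin n)) :
    l1Norm (restrict x S) = ∑ i ∈ S, |x i| := by
  simp [l1Norm, restrict, apply_ite abs]

/-- Expansion makes `Φ` robustly injective on nearly sparse vectors: since the mass of `v` does not
exceed that of `u`, the difference `u - v` puts, up to twice the tail of `u`, at least half of its
mass on `S`. -/
lemma l1Norm_sub_le {n m k d : ℕ} (hk : 1 ≤ k) (G : BipartiteGraph n m)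
    (hG : G.IsExpander (2 * k) (1 / 16) d) (u v : Fin n → ℝ) (huv : l1Norm v ≤ l1Norm u)
    (S : Finset (Fin n)) (hS : S.card = k) :
    l1Norm (u - v) ≤ 4 * l1Norm (restrict u Sᶜ) +
      3 * l1Norm ((G.sensingMatrix d).mulVec (u - v)) := by
  obtain ⟨i₀, -⟩ : S.Nonempty := Finset.card_pos.1 (by omega)
  have hd : (0 : ℝ) < d := by exact_mod_cast hG.degree_pos (by omega) i₀
  have h1 := sum_abs_le_of_expansion hk G.nbr ((d : ℝ) / 16) (by positivity) hG.left_regular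
    (fun T hT => by
      rcases T.eq_empty_or_nonempty with rfl | hne
      · simp
      · have := hG.expansion T hne hT
        rw [BipartiteGraph.nbrs] at this
        linarith) (u - v) S hS
  have h2 : ∑ j, |∑ i, if j ∈ G.nbr i then (u - v) i else 0| =
      d * l1Norm ((G.sensingMatrix d).mulVec (u - v)) := by
    simp only [l1Norm, sensingMatrix_mulVec, abs_mul, ← Finset.mul_sum, abs_inv, Nat.abs_cast]
    field_simp
  rw [h2] at h1
  have h3 : ∑ i ∈ S, |(u - v) i| ≤
      l1Norm ((G.sensingMatrix d).mulVec (u - v)) + 1 / 8 * l1Norm (u - v) := by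
    refine le_of_mul_le_mul_left (h1.trans (le_of_eq ?_)) hd
    rw [← l1Norm]; ring
  have h4 : ∑ i ∈ Sᶜ, |(u - v) i| ≤ ∑ i ∈ Sᶜ, |u i| + ∑ i ∈ Sᶜ, |v i| := by
    rw [← Finset.sum_add_distrib]
    exact Finset.sum_le_sum fun i _ => abs_sub _ _
  have h5 : ∑ i ∈ S, |u i| ≤ ∑ i ∈ S, |v i| + ∑ i ∈ S, |(u - v) i| := by
    rw [← Finset.sum_add_distrib]
    refine Finset.sum_le_sum fun i _ => ?_
    have := abs_add_le (v i) (u i - v i)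
    rw [add_sub_cancel] at this
    exact this
  have h6 := l1Norm_eq_sum_add_sum_compl u S
  have h7 := l1Norm_eq_sum_add_sum_compl v S
  have h8 := l1Norm_eq_sum_add_sum_compl (u - v) S
  have h9 : 0 ≤ l1Norm (restrict u Sᶜ) := Finset.sum_nonneg fun i _ => abs_nonneg _
  have h10 : 0 ≤ l1Norm ((G.sensingMatrix d).mulVec (u - v)) :=
    Finset.sum_nonneg fun i _ => abs_nonneg _
  rw [l1Norm_restrict] at h9 ⊢
  linarith

/-! ### Moments of the Poisson distribution -/

lemma integral_exp_mul_poissonMeasure (r : NNReal) (t : ℝ) :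
    ∫ k : ℕ, Real.exp (t * k) ∂(poissonMeasure r) = Real.exp (r * (Real.exp t - 1)) := by
  rw [integral_poissonMeasure]
  have h := (NormedSpace.expSeries_div_hasSum_exp ((r : ℝ) * Real.exp t)).mul_left
    (Real.exp (-(r : ℝ)))
  rw [← Real.exp_eq_exp_ℝ, ← Real.exp_add] at h
  rw [show (r : ℝ) * (Real.exp t - 1) = -r + r * Real.exp t by ring, ← h.tsum_eq]
  refine tsum_congr fun k => ?_
  rw [smul_eq_mul, mul_pow, ← Real.exp_nat_mul, mul_comm t]
  ring

lemma hasSum_mul_natCast_poisson (r : NNReal) :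
    HasSum (fun k : ℕ => Real.exp (-(r : ℝ)) * (r : ℝ) ^ k / (k.factorial : ℝ) * k) r := by
  rw [← hasSum_nat_add_iff' 1]
  have h := (hasSum_one_poissonMeasure r).mul_left (r : ℝ)
  simp only [Finset.range_one, Finset.sum_singleton, Nat.cast_zero, mul_zero, sub_zero]
  rw [mul_one] at h
  refine h.congr_fun fun k => ?_
  rw [Nat.factorial_succ]
  push_cast
  have : (k : ℝ) + 1 ≠ 0 := by positivity
  field_simp
  ring

lemma integrable_natCast_poissonMeasure (r : NNReal) :
    Integrable (fun k : ℕ => (k : ℝ)) (poissonMeasure r) := by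
  rw [integrable_poissonMeasure_iff]
  simpa using (hasSum_mul_natCast_poisson r).summable

lemma integral_natCast_poissonMeasure (r : NNReal) :
    ∫ k : ℕ, (k : ℝ) ∂(poissonMeasure r) = r := by
  rw [integral_poissonMeasure]
  simpa using (hasSum_mul_natCast_poisson r).tsum_eq

/-! ### Hellinger distance and likelihood ratio of Poisson vectors -/

/-- The squared Hellinger distance `∑ⱼ (√βⱼ - √qⱼ)²` of two vectors of Poisson intensities. -/
noncomputable def sqHellinger {m : ℕ} (β q : Fin m → ℝ) : ℝ := ∑ j, (√(β j) - √(q j)) ^ 2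

lemma sqHellinger_nonneg {m : ℕ} (β q : Fin m → ℝ) : 0 ≤ sqHellinger β q :=
  Finset.sum_nonneg fun _ _ => sq_nonneg _

/-- The log-likelihood ratio, at the observation `y`, of the Poisson intensities `q` against `β`.
Where `β j = 0`, the convention `Real.log 0 = 0` is harmless, since then `y j = 0` almost surely. -/
noncomputable def logLikelihoodRatio {m : ℕ} (β q : Fin m → ℝ) (y : Fin m → ℕ) : ℝ :=
  ∑ j, ((y j : ℝ) * (Real.log (q j) - Real.log (β j)) - q j + β j)

lemma mul_exp_half_log_sub_log {b q : ℝ} (hb : 0 ≤ b) (hq : 0 < q) :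
    b * Real.exp ((Real.log q - Real.log b) / 2) = √b * √q := by
  rcases hb.eq_or_lt with rfl | hb
  · simp
  rw [sub_div, ← Real.log_sqrt hq.le, ← Real.log_sqrt hb.le, Real.exp_sub,
    Real.exp_log (Real.sqrt_pos.2 hq), Real.exp_log (Real.sqrt_pos.2 hb)]
  have h := Real.sq_sqrt hb.le
  have h' := (Real.sqrt_pos.2 hb).ne'
  field_simp
  rw [h]

section PoissonVector

variable {m : ℕ} {Ω : Type*} [MeasurableSpace Ω] {P : Measure Ω}
  {Y : Ω → Fin m → ℕ} {β : Fin m → ℝ}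

lemma IsPoissonVector.integrable_natCast (hY : IsPoissonVector P Y β) (j : Fin m) :
    Integrable (fun ω => (Y ω j : ℝ)) P := by
  have h := integrable_natCast_poissonMeasure (β j).toNNReal
  rw [← (hY.1 j).map_eq] at h
  exact (integrable_map_measure h.aestronglyMeasurable (hY.1 j).aemeasurable).1 h

lemma IsPoissonVector.integral_natCast (hY : IsPoissonVector P Y β) (hβ : ∀ j, 0 ≤ β j)
    (j : Fin m) : ∫ ω, (Y ω j : ℝ) ∂P = β j := by
  have h := (hY.1 j).integral_comp (f := fun k : ℕ => (k : ℝ)) .of_discrete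
  rw [integral_natCast_poissonMeasure, Real.coe_toNNReal _ (hβ j)] at h
  exact h

/-- The affinity `E √(dP_q / dP_β)` of two Poisson vectors is `exp (-H² / 2)`. -/
lemma IsPoissonVector.integral_exp_half_logLikelihoodRatio [IsProbabilityMeasure P]
    (hY : IsPoissonVector P Y β) (hβ : ∀ j, 0 ≤ β j) {q : Fin m → ℝ} (hq : ∀ j, 0 < q j) :
    ∫ ω, Real.exp (logLikelihoodRatio β q (Y ω) / 2) ∂P = Real.exp (-sqHellinger β q / 2) := by
  set s : Fin m → ℝ := fun j => (Real.log (q j) - Real.log (β j)) / 2 with hs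
  have hind : iIndepFun (fun j ω => s j * (Y ω j : ℝ)) P :=
    hY.2.comp (fun j (k : ℕ) => s j * (k : ℝ)) fun j => .of_discrete
  have hmeas : ∀ j, AEMeasurable (fun ω => s j * (Y ω j : ℝ)) P := fun j =>
    (hY.integrable_natCast j).aemeasurable.const_mul _
  have h1 := hind.mgf_sum₀ (t := 1) hmeas Finset.univ
  have h2 : ∀ j, mgf (fun ω => s j * (Y ω j : ℝ)) P 1 =
      Real.exp (√(β j) * √(q j) - β j) := by
    intro j
    have h := (hY.1 j).integral_comp (f := fun k : ℕ => Real.exp (s j * (k : ℝ))) .of_discrete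
    rw [integral_exp_mul_poissonMeasure, Real.coe_toNNReal _ (hβ j), mul_sub, mul_one,
      mul_exp_half_log_sub_log (hβ j) (hq j)] at h
    simpa [mgf] using h
  simp only [h2, ← Real.exp_sum] at h1
  have h3 : ∀ ω, Real.exp (logLikelihoodRatio β q (Y ω) / 2) =
      Real.exp (1 * (∑ j, fun ω => s j * (Y ω j : ℝ)) ω) * Real.exp (∑ j, (β j - q j) / 2) := by
    intro ω
    rw [← Real.exp_add, one_mul, Finset.sum_apply, ← Finset.sum_add_distrib, logLikelihoodRatio,
      Finset.sum_div]
    congr 1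
    refine Finset.sum_congr rfl fun j _ => ?_
    simp only [hs]
    ring
  simp only [h3]
  rw [integral_mul_const]
  rw [mgf] at h1
  rw [h1, ← Real.exp_add, ← Finset.sum_add_distrib, sqHellinger, ← Finset.sum_neg_distrib,
    Finset.sum_div]
  congr 1
  refine Finset.sum_congr rfl fun j _ => ?_
  have h4 := Real.sq_sqrt (hβ j)
  have h5 := Real.sq_sqrt (hq j).le
  linear_combination (1 / 2 : ℝ) * h4 + 1 / 2 * h5

lemma IsPoissonVector.integrable_exp_half_logLikelihoodRatio [IsProbabilityMeasure P]
    (hY : IsPoissonVector P Y β) (hβ : ∀ j, 0 ≤ β j) {q : Fin m → ℝ} (hq : ∀ j, 0 < q j) :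
    Integrable (fun ω => Real.exp (logLikelihoodRatio β q (Y ω) / 2)) P := by
  by_contra h
  have h1 := hY.integral_exp_half_logLikelihoodRatio hβ hq
  rw [integral_undef h] at h1
  exact (Real.exp_pos _).ne h1

lemma IsPoissonVector.integrable_logLikelihoodRatio [IsProbabilityMeasure P]
    (hY : IsPoissonVector P Y β) (q : Fin m → ℝ) :
    Integrable (fun ω => logLikelihoodRatio β q (Y ω)) P :=
  integrable_finsetSum _ fun j _ =>
    (((hY.integrable_natCast j).mul_const _).sub (integrable_const _)).add (integrable_const _)

lemma mul_log_sub_log_le {b q : ℝ} (hb : 0 ≤ b) (hq : 0 < q) :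
    -(b * (Real.log q - Real.log b) - q + b) ≤ (b - q) ^ 2 / q := by
  rcases hb.eq_or_lt with rfl | hb
  · have : (0 - q) ^ 2 / q = q := by field_simp; ring
    rw [this]; linarith
  have h := Real.log_le_sub_one_of_pos (div_pos hb hq)
  rw [Real.log_div hb.ne' hq.ne'] at h
  have h1 := mul_le_mul_of_nonneg_left h hb.le
  have h2 : (b - q) ^ 2 / q = b * (b / q - 1) - b + q := by field_simp; ring
  rw [h2]; linarith

/-- The Kullback–Leibler divergence of Poisson vectors is at most their `χ²` divergence. -/
lemma IsPoissonVector.neg_integral_logLikelihoodRatio_le [IsProbabilityMeasure P]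
    (hY : IsPoissonVector P Y β) (hβ : ∀ j, 0 ≤ β j) {q : Fin m → ℝ} (hq : ∀ j, 0 < q j) :
    -∫ ω, logLikelihoodRatio β q (Y ω) ∂P ≤ ∑ j, (β j - q j) ^ 2 / q j := by
  have h1 : ∫ ω, logLikelihoodRatio β q (Y ω) ∂P =
      ∑ j, (β j * (Real.log (q j) - Real.log (β j)) - q j + β j) := by
    simp only [logLikelihoodRatio]
    have hi : ∀ j, Integrable (fun ω => (Y ω j : ℝ) * (Real.log (q j) - Real.log (β j)) - q j) P :=
      fun j => ((hY.integrable_natCast j).mul_const _).sub (integrable_const _)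
    have hi' : ∀ j, Integrable
        (fun ω => (Y ω j : ℝ) * (Real.log (q j) - Real.log (β j)) - q j + β j) P :=
      fun j => (hi j).add (integrable_const _)
    rw [integral_finsetSum Finset.univ fun j _ => hi' j]
    refine Finset.sum_congr rfl fun j _ => ?_
    rw [integral_add (hi j) (integrable_const _), integral_sub
      ((hY.integrable_natCast j).mul_const _) (integrable_const _), integral_mul_const,
      hY.integral_natCast hβ]
    simp
  rw [h1, ← Finset.sum_neg_distrib]
  exact Finset.sum_le_sum fun j _ => mul_log_sub_log_le (hβ j) (hq j)

/-! ### The oracle inequality -/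

/-- The oracle inequality for penalized maximum likelihood. The estimate enters the argument only
through the sum over all candidates of the weighted affinities `√(dP_q / dP_β) e^(-pen) e^(H² / 2)`,
whose expectation is at most `1` by the Kraft inequality. -/
theorem IsPoissonVector.integral_sqHellinger_le [IsProbabilityMeasure P] {n : ℕ}
    (hY : IsPoissonVector P Y β) (hβ : ∀ j, 0 ≤ β j) (Φ : Matrix (Fin m) (Fin n) ℝ)
    (pen : (Fin n → ℝ) → ℝ) (Γ : Finset (Fin n → ℝ)) (hΓ : ∀ x ∈ Γ, ∀ j, 0 < Φ.mulVec x j)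
    (hKraft : ∑ x ∈ Γ, Real.exp (-pen x) ≤ 1) (xhat : Ω → Fin n → ℝ)
    (hxhat : ∀ ω, IsMapEstimate Φ pen Γ (Y ω) (xhat ω))
    (hint : Integrable (fun ω => sqHellinger β (Φ.mulVec (xhat ω))) P)
    {x : Fin n → ℝ} (hx : x ∈ Γ) :
    ∫ ω, sqHellinger β (Φ.mulVec (xhat ω)) ∂P ≤
      ∑ j, (β j - Φ.mulVec x j) ^ 2 / Φ.mulVec x j + 2 * pen x := by
  set c : (Fin n → ℝ) → ℝ := fun z =>
    Real.exp (-pen z) * Real.exp (sqHellinger β (Φ.mulVec z) / 2) with hc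
  set Z : Ω → ℝ := fun ω =>
    ∑ z ∈ Γ, Real.exp (logLikelihoodRatio β (Φ.mulVec z) (Y ω) / 2) * c z with hZ
  have hterm : ∀ z ∈ Γ, Integrable
      (fun ω => Real.exp (logLikelihoodRatio β (Φ.mulVec z) (Y ω) / 2) * c z) P := fun z hz =>
    (hY.integrable_exp_half_logLikelihoodRatio hβ (hΓ z hz)).mul_const _
  have hZint : Integrable Z P := integrable_finsetSum _ hterm
  have hZle : ∫ ω, Z ω ∂P ≤ 1 := by
    refine le_trans (le_of_eq ?_) hKraft
    rw [hZ, integral_finsetSum _ hterm]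
    refine Finset.sum_congr rfl fun z hz => ?_
    rw [integral_mul_const, hY.integral_exp_half_logLikelihoodRatio hβ (hΓ z hz), hc]
    simp only [← Real.exp_add]
    congr 1
    ring
  have hobj : ∀ ω z, logLikelihoodRatio β (Φ.mulVec z) (Y ω) - 2 * pen z =
      ∑ j, (β j - (Y ω j : ℝ) * Real.log (β j)) - mapObjective Φ pen (Y ω) z := by
    intro ω z
    rw [mapObjective, ← sub_sub, ← Finset.sum_sub_distrib, logLikelihoodRatio]
    congr 1
    exact Finset.sum_congr rfl fun j _ => by ring
  have hpt : ∀ ω, sqHellinger β (Φ.mulVec (xhat ω)) ≤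
      2 * (Z ω - 1) - logLikelihoodRatio β (Φ.mulVec x) (Y ω) + 2 * pen x := by
    intro ω
    obtain ⟨hmem, hmin⟩ := hxhat ω
    have h1 : Real.exp (logLikelihoodRatio β (Φ.mulVec (xhat ω)) (Y ω) / 2) * c (xhat ω) ≤ Z ω :=
      Finset.single_le_sum
        (f := fun z => Real.exp (logLikelihoodRatio β (Φ.mulVec z) (Y ω) / 2) * c z)
        (fun z _ => by positivity) hmem
    simp only [hc, ← Real.exp_add] at h1
    have h2 := Real.add_one_le_exp (logLikelihoodRatio β (Φ.mulVec (xhat ω)) (Y ω) / 2 +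
      (-pen (xhat ω) + sqHellinger β (Φ.mulVec (xhat ω)) / 2))
    linarith [hobj ω x, hobj ω (xhat ω), hmin x hx]
  have hL := hY.integrable_logLikelihoodRatio (Φ.mulVec x)
  have hB1 : Integrable (fun ω => 2 * (Z ω - 1)) P := (hZint.sub (integrable_const _)).const_mul _
  have hB2 : Integrable
      (fun ω => 2 * (Z ω - 1) - logLikelihoodRatio β (Φ.mulVec x) (Y ω)) P := hB1.sub hL
  have h1 := integral_mono hint (hB2.add (integrable_const (2 * pen x))) hpt
  have h2 : ∫ ω, (2 * (Z ω - 1) - logLikelihoodRatio β (Φ.mulVec x) (Y ω) + 2 * pen x) ∂P =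
      2 * (∫ ω, Z ω ∂P - 1) - ∫ ω, logLikelihoodRatio β (Φ.mulVec x) (Y ω) ∂P + 2 * pen x := by
    rw [integral_add hB2 (integrable_const _), integral_sub hB1 hL, integral_const_mul,
      integral_sub hZint (integrable_const _)]
    simp
  have h3 := hY.neg_integral_logLikelihoodRatio_le hβ (hΓ x hx)
  calc _ ≤ _ := h1
    _ = _ := h2
    _ ≤ _ := by linarith

end PoissonVector

/-! ### Intensities of the shifted candidates -/

lemma l1Norm_nonneg {n : ℕ} (x : Fin n → ℝ) : 0 ≤ l1Norm x :=
  Finset.sum_nonneg fun _ _ => abs_nonneg _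

lemma l1Norm_add_le {n : ℕ} (x y : Fin n → ℝ) : l1Norm (x + y) ≤ l1Norm x + l1Norm y := by
  simp only [l1Norm, ← Finset.sum_add_distrib]
  exact Finset.sum_le_sum fun i _ => abs_add_le _ _

lemma l1Norm_sub_le_add {n : ℕ} (x y : Fin n → ℝ) : l1Norm (x - y) ≤ l1Norm x + l1Norm y := by
  simp only [l1Norm, ← Finset.sum_add_distrib]
  exact Finset.sum_le_sum fun i _ => abs_sub _ _

lemma l1Norm_smul_indexVector {n : ℕ} {lam : ℝ} (hlam : 0 ≤ lam) (L : Finset (Fin n)) :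
    l1Norm (lam • indexVector L) = lam * L.card := by
  simp [l1Norm, indexVector, apply_ite abs, abs_of_nonneg hlam, mul_comm]

lemma l1Norm_sensingMatrix_mulVec_le {n m d : ℕ} (G : BipartiteGraph n m)
    (hG : ∀ i, (G.nbr i).card = d) (x : Fin n → ℝ) :
    l1Norm ((G.sensingMatrix d).mulVec x) ≤ l1Norm x := by
  have h1 : ∀ j, |(G.sensingMatrix d).mulVec x j| ≤
      (d : ℝ)⁻¹ * ∑ i, if j ∈ G.nbr i then |x i| else 0 := by
    intro j
    rw [sensingMatrix_mulVec, abs_mul, abs_inv, Nat.abs_cast]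
    refine mul_le_mul_of_nonneg_left ((Finset.abs_sum_le_sum_abs _ _).trans (le_of_eq ?_))
      (by positivity)
    exact Finset.sum_congr rfl fun i _ => by split_ifs <;> simp
  refine (Finset.sum_le_sum fun j _ => h1 j).trans ?_
  rw [← Finset.mul_sum, Finset.sum_comm]
  have h2 : ∀ i, ∑ j, (if j ∈ G.nbr i then |x i| else 0) = d * |x i| := by
    intro i; simp [hG]
  simp only [h2, ← Finset.mul_sum, ← mul_assoc]
  exact mul_le_of_le_one_left (l1Norm_nonneg x) inv_mul_le_one

/-- The shift by `lam` on a set of nodes covering every check node keeps the intensities of the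
candidates away from zero. -/
lemma div_le_sensingMatrix_mulVec {n m : ℕ} (d : ℕ) (G : BipartiteGraph n m) (L : Finset (Fin n))
    (hL : G.nbrs L = Finset.univ) {f : Fin n → ℝ} (hf : ∀ i, 0 ≤ f i) {lam : ℝ} (hlam : 0 < lam)
    (j : Fin m) : lam / d ≤ (G.sensingMatrix d).mulVec (f + lam • indexVector L) j := by
  obtain ⟨i, hiL, hij⟩ := Finset.mem_biUnion.1 (hL ▸ Finset.mem_univ j : j ∈ G.nbrs L)
  have hnn : ∀ i, 0 ≤ (f + lam • indexVector L) i := fun i => by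
    have := hf i
    simp only [indexVector, Pi.add_apply, Pi.smul_apply, smul_eq_mul]
    split_ifs <;> simp <;> linarith
  rw [sensingMatrix_mulVec, div_eq_inv_mul]
  refine mul_le_mul_of_nonneg_left ?_ (by positivity)
  have h1 := Finset.single_le_sum
    (f := fun i => if j ∈ G.nbr i then (f + lam • indexVector L) i else 0)
    (fun i _ => by split_ifs; exacts [hnn i, le_rfl]) (Finset.mem_univ i)
  refine le_trans ?_ h1
  simp [hij, indexVector, hiL, hf i]

lemma l1Norm_sub_le_sqrt_sqHellinger {m : ℕ} {β q : Fin m → ℝ} (hβ : ∀ j, 0 ≤ β j)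
    (hq : ∀ j, 0 ≤ q j) :
    l1Norm (β - q) ≤ √(sqHellinger β q) * √(2 * (l1Norm β + l1Norm q)) := by
  have h1 : ∀ j, |(β - q) j| = |√(β j) - √(q j)| * (√(β j) + √(q j)) := by
    intro j
    rw [← abs_of_nonneg (add_nonneg (Real.sqrt_nonneg (β j)) (Real.sqrt_nonneg (q j))), ← abs_mul,
      mul_comm, ← sq_sub_sq, Real.sq_sqrt (hβ j), Real.sq_sqrt (hq j), Pi.sub_apply]
  have h2 := Real.sum_mul_le_sqrt_mul_sqrt Finset.univ (fun j => |√(β j) - √(q j)|)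
    fun j => √(β j) + √(q j)
  simp only [← h1, sq_abs] at h2
  refine h2.trans (mul_le_mul_of_nonneg_left (Real.sqrt_le_sqrt ?_) (Real.sqrt_nonneg _))
  rw [l1Norm, l1Norm, ← Finset.sum_add_distrib, Finset.mul_sum]
  refine Finset.sum_le_sum fun j _ => ?_
  rw [abs_of_nonneg (hβ j), abs_of_nonneg (hq j)]
  nlinarith [sq_nonneg (√(β j) - √(q j)), Real.sq_sqrt (hβ j), Real.sq_sqrt (hq j)]

/-- Candidates whose intensities are at least `c⁻¹` are within `χ²` divergence `c * ‖β - q‖₁²`. -/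
lemma sum_sq_div_le {m : ℕ} {β q : Fin m → ℝ} {c : ℝ} (hc : 0 < c) (hq : ∀ j, c⁻¹ ≤ q j) :
    ∑ j, (β j - q j) ^ 2 / q j ≤ c * l1Norm (β - q) ^ 2 := by
  have h1 : ∀ j, (β j - q j) ^ 2 / q j ≤ c * |(β - q) j| ^ 2 := by
    intro j
    have hqj : 0 < q j := (inv_pos.2 hc).trans_le (hq j)
    rw [sq_abs, div_le_iff₀ hqj, Pi.sub_apply]
    have h2 : 1 ≤ c * q j := by
      have := mul_le_mul_of_nonneg_left (hq j) hc.le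
      rwa [mul_inv_cancel₀ hc.ne'] at this
    nlinarith [sq_nonneg (β j - q j)]
  refine (Finset.sum_le_sum fun j _ => h1 j).trans ?_
  rw [← Finset.mul_sum]
  exact mul_le_mul_of_nonneg_left
    (Finset.sum_sq_le_sq_sum_of_nonneg fun j _ => abs_nonneg _) hc.le

/-! ### Integrals over the estimate, and the risk bound -/

lemma integrable_comp_of_mem_finset {Ω E : Type*} [MeasurableSpace Ω] [MeasurableSpace E]
    {P : Measure Ω} [IsFiniteMeasure P] {X : Ω → E} (hX : AEMeasurable X P) {s : Finset E}
    (hs : ∀ ω, X ω ∈ s) {F : E → ℝ} (hF : Measurable F) : Integrable (fun ω => F (X ω)) P := by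
  refine Integrable.of_bound (hF.comp_aemeasurable hX).aestronglyMeasurable (∑ x ∈ s, ‖F x‖)
    (ae_of_all _ fun ω => ?_)
  exact Finset.single_le_sum (f := fun x => ‖F x‖) (fun x _ => norm_nonneg _) (hs ω)

lemma integral_sqrt_le {Ω : Type*} [MeasurableSpace Ω] {P : Measure Ω} [IsProbabilityMeasure P]
    {h : Ω → ℝ} (h0 : ∀ ω, 0 ≤ h ω) (hi : Integrable h P) (hs : Integrable (fun ω => √(h ω)) P) :
    ∫ ω, √(h ω) ∂P ≤ √(∫ ω, h ω ∂P) :=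
  Real.strictConcaveOn_sqrt.concaveOn.le_map_integral Real.continuous_sqrt.continuousOn isClosed_Ici
    (ae_of_all _ h0) hi hs

end ExpanderPoisson

theorem mainTheorem1
    {n m k d : ℕ} (hk : 1 ≤ k)
    -- the `(2k, 1/16)`-expander and the set `L` of variable nodes covering all check nodes
    (G : BipartiteGraph n m) (hG : G.IsExpander (2 * k) (1 / 16) d)
    (L : Finset (Fin n)) (hLcard : L.card ≤ m) (hLcover : G.nbrs L = Finset.univ)
    -- the signal, with its `k` largest coordinates
    (α : Fin n → ℝ) (hα : l1Norm α = 1)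
    (hΦα : ∀ j, 0 ≤ (G.sensingMatrix d).mulVec α j)
    (S : Finset (Fin n)) (hS : IsLargestCoords α k S)
    -- the candidates and the penalty
    (Θ : Finset (Fin n → ℝ)) (hΘ : Θ.Nonempty)
    (hΘsimplex : ∀ f ∈ Θ, l1Norm f = 1 ∧ ∀ i, 0 ≤ f i)
    (lam : ℝ) (hlam : 0 < lam)
    (pen : (Fin n → ℝ) → ℝ) (hpen : ∀ x ∈ shiftedCandidates Θ lam L, 0 ≤ pen x)
    (hKraft : ∑ x ∈ shiftedCandidates Θ lam L, Real.exp (-pen x) ≤ 1)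
    -- the Poisson observation, the MAP estimate and the corresponding element of `Θ`
    {Ω : Type*} [MeasurableSpace Ω] (P : Measure Ω) [IsProbabilityMeasure P]
    (Y : Ω → Fin m → ℕ) (hY : IsPoissonVector P Y ((G.sensingMatrix d).mulVec α))
    (xhat fhat : Ω → Fin n → ℝ) (hfhat : AEMeasurable fhat P)
    (hxhat : ∀ ω, IsMapEstimate (G.sensingMatrix d) pen (shiftedCandidates Θ lam L) (Y ω) (xhat ω))
    (hfx : ∀ ω, fhat ω ∈ Θ ∧ xhat ω = fhat ω + lam • indexVector L) :
    Integrable (fun ω => l1Norm (α - fhat ω)) P ∧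
      ∫ ω, l1Norm (α - fhat ω) ∂P ≤
        3 * lam * m + 4 * l1Norm (restrict α Sᶜ) +
          3 * √6 * Θ.inf' hΘ (fun f =>
            √(d / lam) * (l1Norm (α - f) + lam * m) + √(2 * pen (f + lam • indexVector L))) := by
  have hint : Integrable (fun ω => l1Norm (α - fhat ω)) P :=
    integrable_comp_of_mem_finset hfhat (fun ω => (hfx ω).1) (F := fun f => l1Norm (α - f))
      (by unfold l1Norm; fun_prop)
  refine ⟨hint, ?_⟩
  obtain ⟨i₀, -⟩ : S.Nonempty := Finset.card_pos.1 (by have := hS.1; omega)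
  have hd : (0 : ℝ) < d := by exact_mod_cast hG.degree_pos (by omega) i₀
  have hL : l1Norm (lam • indexVector L) ≤ lam * m := by
    rw [l1Norm_smul_indexVector hlam.le]
    exact mul_le_mul_of_nonneg_left (by exact_mod_cast hLcard) hlam.le
  have hσ := l1Norm_nonneg (restrict α Sᶜ)
  rcases lt_or_ge 1 (lam * m) with hlm | hlm
  · -- a large shift makes the bound exceed the diameter of the `ℓ₁` sphere
    have hinf : 0 ≤ Θ.inf' hΘ (fun f =>
        √(d / lam) * (l1Norm (α - f) + lam * m) + √(2 * pen (f + lam • indexVector L))) := by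
      refine Finset.le_inf' _ _ fun f hf => ?_
      have := l1Norm_nonneg (α - f)
      positivity
    have h1 : ∫ ω, l1Norm (α - fhat ω) ∂P ≤ ∫ _, (2 : ℝ) ∂P := by
      refine integral_mono hint (integrable_const _) fun ω => ?_
      have := l1Norm_sub_le_add α (fhat ω)
      rw [hα, (hΘsimplex _ (hfx ω).1).1] at this
      linarith
    have h2 : 0 ≤ 3 * √6 * Θ.inf' hΘ (fun f =>
        √(d / lam) * (l1Norm (α - f) + lam * m) + √(2 * pen (f + lam • indexVector L))) :=
      mul_nonneg (by positivity) hinf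
    simp only [integral_const, probReal_univ, one_smul] at h1
    linarith
  set Φ := G.sensingMatrix d with hΦ
  set β := Φ.mulVec α with hβ
  set H : Ω → ℝ := fun ω => sqHellinger β (Φ.mulVec (xhat ω)) with hH
  have hq : ∀ f ∈ Θ, ∀ j, ((d : ℝ) / lam)⁻¹ ≤ Φ.mulVec (f + lam • indexVector L) j :=
    fun f hf j => by
      rw [inv_div]
      exact div_le_sensingMatrix_mulVec d G L hLcover (hΘsimplex f hf).2 hlam j
  have hdl : 0 < (d : ℝ) / lam := div_pos hd hlam
  have hqpos : ∀ f ∈ Θ, ∀ j, 0 < Φ.mulVec (f + lam • indexVector L) j :=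
    fun f hf j => (inv_pos.2 hdl).trans_le (hq f hf j)
  have hHmeas : Measurable fun f : Fin n → ℝ =>
      sqHellinger β (Φ.mulVec (f + lam • indexVector L)) := by
    unfold sqHellinger Matrix.mulVec dotProduct
    fun_prop
  have hHint : Integrable H P := by
    simp only [hH, fun ω => (hfx ω).2]
    exact integrable_comp_of_mem_finset hfhat (fun ω => (hfx ω).1) hHmeas
  have hsHint : Integrable (fun ω => √(H ω)) P := by
    simp only [hH, fun ω => (hfx ω).2]
    exact integrable_comp_of_mem_finset hfhat (fun ω => (hfx ω).1) hHmeas.sqrt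
  have hβ1 : l1Norm β ≤ 1 := hα ▸ l1Norm_sensingMatrix_mulVec_le G hG.left_regular α
  -- the factor `√6` is `√(2 * (1 + 2))`, the total intensities being at most `1` and `1 + lam * m`
  have hpt : ∀ ω, l1Norm (α - fhat ω) ≤
      3 * √6 * √(H ω) + (3 * lam * m + 4 * l1Norm (restrict α Sᶜ)) := by
    intro ω
    obtain ⟨hf, hx⟩ := hfx ω
    have hf1 := (hΘsimplex _ hf).1
    have h1 := l1Norm_sub_le hk G hG α (fhat ω) (by rw [hα, hf1]) S hS.1
    have h2 : Φ.mulVec (α - fhat ω) =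
        (β - Φ.mulVec (xhat ω)) + Φ.mulVec (lam • indexVector L) := by
      rw [hx, Matrix.mulVec_add, Matrix.mulVec_sub]
      abel
    have h3 := l1Norm_add_le (β - Φ.mulVec (xhat ω)) (Φ.mulVec (lam • indexVector L))
    have h4 := l1Norm_sensingMatrix_mulVec_le G hG.left_regular (lam • indexVector L)
    have h5 : l1Norm (Φ.mulVec (xhat ω)) ≤ 2 := by
      refine (l1Norm_sensingMatrix_mulVec_le G hG.left_regular _).trans ?_
      rw [hx]
      linarith [l1Norm_add_le (fhat ω) (lam • indexVector L)]
    have h6 : l1Norm (β - Φ.mulVec (xhat ω)) ≤ √(H ω) * √6 := by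
      refine (l1Norm_sub_le_sqrt_sqHellinger hΦα
        (fun j => hx ▸ (hqpos _ hf j).le)).trans ?_
      exact mul_le_mul_of_nonneg_left (Real.sqrt_le_sqrt (by linarith)) (Real.sqrt_nonneg _)
    rw [← hΦ, h2] at h1
    linarith
  obtain ⟨f, hf, hfeq⟩ := Finset.exists_mem_eq_inf' hΘ fun f =>
    √(d / lam) * (l1Norm (α - f) + lam * m) + √(2 * pen (f + lam • indexVector L))
  rw [hfeq]
  have hfΓ : f + lam • indexVector L ∈ shiftedCandidates Θ lam L :=
    Finset.mem_image_of_mem _ hf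
  have hΓ : ∀ x ∈ shiftedCandidates Θ lam L, ∀ j, 0 < Φ.mulVec x j := by
    intro x hx
    obtain ⟨g, hg, rfl⟩ := Finset.mem_image.1 hx
    exact hqpos g hg
  have horacle := hY.integral_sqHellinger_le hΦα Φ pen _ hΓ hKraft xhat hxhat hHint hfΓ
  have hdist : l1Norm (β - Φ.mulVec (f + lam • indexVector L)) ≤ l1Norm (α - f) + lam * m := by
    rw [hβ, ← Matrix.mulVec_sub, ← sub_sub]
    refine (l1Norm_sensingMatrix_mulVec_le G hG.left_regular _).trans ?_
    exact (l1Norm_sub_le_add _ _).trans (by linarith)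
  have hEH : ∫ ω, H ω ∂P ≤ (√(d / lam) * (l1Norm (α - f) + lam * m) +
      √(2 * pen (f + lam • indexVector L))) ^ 2 := by
    have h1 := sum_sq_div_le (β := β) hdl (hq f hf)
    have h2 := mul_le_mul_of_nonneg_left (pow_le_pow_left₀ (l1Norm_nonneg _) hdist 2) hdl.le
    have h3 := Real.sq_sqrt hdl.le
    have h4 := Real.sq_sqrt (mul_nonneg zero_le_two (hpen _ hfΓ))
    have h5 : 0 ≤ √(d / lam) * (l1Norm (α - f) + lam * m) *
        √(2 * pen (f + lam • indexVector L)) := by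
      have := l1Norm_nonneg (α - f)
      positivity
    rw [add_sq, mul_pow, h3, h4]
    linarith
  have hEs := (integral_sqrt_le (fun ω => sqHellinger_nonneg _ _) hHint hsHint).trans
    (Real.sqrt_le_sqrt hEH)
  rw [Real.sqrt_sq (by have := l1Norm_nonneg (α - f); positivity)] at hEs
  have hE := integral_mono hint ((hsHint.const_mul (3 * √6)).add (integrable_const _)) hpt
  have hE' : ∫ ω, (3 * √6 * √(H ω) + (3 * lam * m + 4 * l1Norm (restrict α Sᶜ))) ∂P =
      3 * √6 * ∫ ω, √(H ω) ∂P + (3 * lam * m + 4 * l1Norm (restrict α Sᶜ)) := by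
    rw [integral_add (hsHint.const_mul _) (integrable_const _), integral_const_mul]
    simp
  calc _ ≤ _ := hE
    _ = _ := hE'
    _ ≤ _ := by linarith [mul_le_mul_of_nonneg_left hEs (by positivity : 0 ≤ 3 * √6)]
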